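/- \textbf{Theorem (the differential method for BV densities).} Let $\|\cdot\|$ be any norm on $\mathbb{R}^d$, let $\mathcal{B}$ be its closed unit ball and $\mathrm{Vert}(\mathcal{B})$ the set of extreme points of $\mathcal{B}$. Let $q$ be a probability density on $\mathbb{R}^d$ of bounded variation: there are a finite Borel measure $|Dq|$ on $\mathbb{R}^d$ and a Borel field $\mathbf{n}:\mathbb{R}^d\to\mathbb{R}^d$ with $\|\mathbf n\|_2=1$ $|Dq|$-almost everywhere such that $$\int q\,\operatorname{div}\phi\,dx=-\int\langle\phi,\mathbf n\rangle\,d|Dq|$$ for every compactly supported $C^1$ field $\phi:\mathbb{R}^d\to\mathbb{R}^d$. (For instance, $q$ may be the uniform density on a bounded set of positive measure and finite perimeter.) Let $|Dq|=|Dq|_{ac}+|Dq|_s$ be the Lebesgue decomposition of $|Dq|$ with respect to the probability measure $q(x)\,dx$, also denoted $q$. For $u\in\mathbb{R}^d$ let $\gamma_u$ be the random variable $$\gamma_u=\langle u,\mathbf n(\delta)\rangle\,\frac{d|Dq|_{ac}}{dq}(\delta),\qquad \delta\sim q .$$ Put $\varphi_u(c)=\Pr[\gamma_u>c]$ and $\varphi_u^{-1}(p)=\inf\{c:\varphi_u(c)\le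 p\}$. For $p\in[0,1]$ and $c=\varphi_u^{-1}(p)$, let $\gamma_u^p$ be the random variable that, with probability $\varphi_u(c)$, is distributed as $\gamma_u$ conditioned on $\gamma_u>c$, equals $c$ with probability $p-\varphi_u(c)$, and equals $0$ with probability $1-p$. Let $$\vartheta_u=\int\max(0,\langle\mathbf n(x),u\rangle)\,d|Dq|_s(x),\qquad \Phi(p)=\max_{u\in\mathrm{Vert}(\mathcal B)}\bigl(\mathbb{E}\,\gamma_u^p+\vartheta_u\bigr).$$ Let $F:\mathbb{R}^d\to[0,1]$ be measurable and let $G(x)=\int q(\delta)F(x+\delta)\,d\delta$ be its smoothing by $q$. Then for every $x\in\mathbb{R}^d$ with $G(x)<1/2$ we have $G(x+\delta)<1/2$ for every $\delta\in\mathbb{R}^d$ with $$\|\delta\|<\int_{G(x)}^{1/2}\frac{1}{\Phi(p)}\,dp ,$$ where the integral takes values in $[0,\infty]$. -/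

import Mathlib

open MeasureTheory
open scoped ENNReal

namespace BVSmoothing

noncomputable section

/-- The divergence of a vector field on `ℝᵈ`. -/
def divergence {d : ℕ} (φ : EuclideanSpace ℝ (Fin d) → EuclideanSpace ℝ (Fin d))
    (x : EuclideanSpace ℝ (Fin d)) : ℝ :=
  ∑ i : Fin d, (fderiv ℝ φ x (EuclideanSpace.single i 1)) i

/-- `q` is a function of bounded variation on `ℝᵈ` with variation measure `|Dq| = μ` and
direction field `n`: `q` is in `L¹`, the measure `μ` is finite, `n` has Euclidean norm one
`μ`-almost everywhere, and `∫ q div φ = - ∫ ⟨φ, n⟩ dμ` for all `C¹` fields `φ` of compact support.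
(These properties determine `μ` uniquely, and `n` up to a `μ`-null set.) -/
structure HasBVDeriv {d : ℕ} (q : EuclideanSpace ℝ (Fin d) → ℝ)
    (μ : Measure (EuclideanSpace ℝ (Fin d)))
    (n : EuclideanSpace ℝ (Fin d) → EuclideanSpace ℝ (Fin d)) : Prop where
  integrable : Integrable q volume
  finite : IsFiniteMeasure μ
  measurable_dir : Measurable n
  norm_dir : ∀ᵐ x ∂μ, ‖n x‖ = 1
  integral_by_parts : ∀ φ : EuclideanSpace ℝ (Fin d) → EuclideanSpace ℝ (Fin d),
    ContDiff ℝ 1 φ → HasCompactSupport φ →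
      ∫ x, q x * divergence φ x = -∫ x, inner ℝ (φ x) (n x) ∂μ

/-- The measure with Lebesgue density `q`. -/
def densityMeasure {d : ℕ} (q : EuclideanSpace ℝ (Fin d) → ℝ) :
    Measure (EuclideanSpace ℝ (Fin d)) :=
  volume.withDensity fun x => ENNReal.ofReal (q x)

/-- The smoothing `G(x) = ∫ q(δ) F(x + δ) dδ` of `F` by the density `q`. -/
def smoothing {d : ℕ} (q F : EuclideanSpace ℝ (Fin d) → ℝ) (x : EuclideanSpace ℝ (Fin d)) : ℝ :=
  ∫ δ, q δ * F (x + δ)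

/-- The random variable `γ_u = ⟨u, n⟩ · d|Dq|_ac / dq` on the probability space `(ℝᵈ, q)`.
`Measure.rnDeriv` is the density of the absolutely continuous part of the Lebesgue decomposition. -/
def gamma {d : ℕ} (q : EuclideanSpace ℝ (Fin d) → ℝ) (μ : Measure (EuclideanSpace ℝ (Fin d)))
    (n : EuclideanSpace ℝ (Fin d) → EuclideanSpace ℝ (Fin d))
    (u δ : EuclideanSpace ℝ (Fin d)) : ℝ :=
  inner ℝ u (n δ) * (μ.rnDeriv (densityMeasure q) δ).toReal

/-- The law of `γ_u` when `δ` is drawn from `q`. -/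
def gammaLaw {d : ℕ} (q : EuclideanSpace ℝ (Fin d) → ℝ) (μ : Measure (EuclideanSpace ℝ (Fin d)))
    (n : EuclideanSpace ℝ (Fin d) → EuclideanSpace ℝ (Fin d))
    (u : EuclideanSpace ℝ (Fin d)) : Measure ℝ :=
  (densityMeasure q).map (gamma q μ n u)

/-- The complementary CDF `c ↦ ν (c, ∞)` of a law `ν` on `ℝ`, for `c ∈ [-∞, ∞]`. -/
def ccdf (ν : Measure ℝ) (c : EReal) : ℝ≥0∞ :=
  ν {y : ℝ | c < (y : EReal)}

/-- The inverse complementary CDF `inf {c | ν (c, ∞) ≤ p}`. The infimum is taken in `[-∞, ∞]`;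
for `0 < p < 1` and a probability law `ν` it is a real number. -/
def ccdfInv (ν : Measure ℝ) (p : ℝ) : EReal :=
  sInf {c : EReal | ccdf ν c ≤ ENNReal.ofReal p}

/-- With `c = ccdfInv ν p`: the law which with probability `ν (c, ∞)` is `ν` conditioned on
`(c, ∞)` (that is, the restriction of `ν` to `(c, ∞)`), equals `c` with probability
`p - ν (c, ∞)`, and equals `0` with probability `1 - p`. (For a probability law `ν` and
`p ∈ [0, 1]`, the middle weight is `0` if `c = ±∞`, and no subtraction is truncated.) -/
def bathtubLaw (ν : Measure ℝ) (p : ℝ) : Measure ℝ :=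
  ν.restrict {y : ℝ | ccdfInv ν p < (y : EReal)}
    + (ENNReal.ofReal p - ccdf ν (ccdfInv ν p)) • Measure.dirac (ccdfInv ν p).toReal
    + ENNReal.ofReal (1 - p) • Measure.dirac 0

/-- `𝔼 γ_u^p`. -/
def bathtubExpectation {d : ℕ} (q : EuclideanSpace ℝ (Fin d) → ℝ)
    (μ : Measure (EuclideanSpace ℝ (Fin d)))
    (n : EuclideanSpace ℝ (Fin d) → EuclideanSpace ℝ (Fin d))
    (u : EuclideanSpace ℝ (Fin d)) (p : ℝ) : ℝ :=
  ∫ y, y ∂(bathtubLaw (gammaLaw q μ n u) p)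

/-- The singular term `ϑ_u = ∫ max(0, ⟨n, u⟩) d|Dq|_s`, where `|Dq|_s` is the part of `|Dq|`
singular with respect to `q`. -/
def theta {d : ℕ} (q : EuclideanSpace ℝ (Fin d) → ℝ) (μ : Measure (EuclideanSpace ℝ (Fin d)))
    (n : EuclideanSpace ℝ (Fin d) → EuclideanSpace ℝ (Fin d))
    (u : EuclideanSpace ℝ (Fin d)) : ℝ :=
  ∫ x, max 0 (inner ℝ (n x) u) ∂(μ.singularPart (densityMeasure q))

/-- `Φ(p)`: the maximum of `𝔼 γ_u^p + ϑ_u` over the extreme points `u` of the unit ball of the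
norm `N`. -/
def Phi {d : ℕ} (N : Seminorm ℝ (EuclideanSpace ℝ (Fin d)))
    (q : EuclideanSpace ℝ (Fin d) → ℝ) (μ : Measure (EuclideanSpace ℝ (Fin d)))
    (n : EuclideanSpace ℝ (Fin d) → EuclideanSpace ℝ (Fin d)) (p : ℝ) : ℝ :=
  sSup ((fun u => bathtubExpectation q μ n u p + theta q μ n u) ''
    Set.extremePoints ℝ {x : EuclideanSpace ℝ (Fin d) | N x ≤ 1})

end

end BVSmoothing

/-!
Write `Q` for the probability measure with density `q`, and suppose first that `F = g` is a `C¹`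
function of compact support with values in `[0, 1]`. Integration by parts gives the derivative of
its smoothing `G` in a direction `v`,
`∂ᵥG(y) = -∫ g(y + z) ⟨v, n(z)⟩ d|Dq|(z)` (`HasBVDeriv.hasDerivAt_smoothing`).
This is a linear function of `-v`, so over the unit ball of the norm it is bounded by its supremum
over the extreme points `u` of the ball, by Krein–Milman. At such a `u`, decompose `|Dq|` with
respect to `Q`. The singular part contributes at most `ϑ_u`. The absolutely continuous part
contributes `∫ f γ_u dQ`, where `f = g(y + ·)` has values in `[0, 1]` and integral `p = G(y)`; by the
bathtub principle (`integral_mul_le_integral_bathtubLaw`) this is at most `𝔼 γ_u^p`. Altogether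
`∂ᵥG(y) ≤ Φ(G(y))` (`HasBVDeriv.neg_integral_mul_inner_le_Phi`).

Hence `h(t) = G(x + t v)` satisfies `h' ≤ Φ(h)`, and separating variables shows that climbing from
`G(x)` to `G(x + δ)` takes time at least `∫ dp / Φ(p)` over the interval between these values
(`setLIntegral_inv_le_of_deriv_le`); no regularity of `Φ` is needed there.

For a general `F`, the singular part of `|Dq|` may charge Lebesgue null sets, on which `F` is
immaterial, so the formula for `∂ᵥG` fails. Instead `F` is approximated almost everywhere by test
functions; by dominated convergence the smoothings converge at the two points `x` and `x + δ`, and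
the bound on the integral of `1 / Φ` passes to the limit (`setLIntegral_Ioo_le_of_tendsto`).
-/

namespace BVSmoothing

open Set Filter Topology

/-! ### A differential inequality in one variable -/

/-- A differential inequality `h' ≤ φ(h)` bounds from below the time `T` that `h` needs to climb
from `h 0` to `h T`. Nothing is assumed of `φ`, not even measurability, and `h` need not be
monotone: the change of variables `p = h t` is made on the set of first hitting times, where `h`
is injective and `h' ≥ 0`. Where `φ p ≤ 0` the integrand is `∞`, and the derivative at the first
hitting time of `p` vanishes. -/
theorem setLIntegral_inv_le_of_deriv_le {h h' φ : ℝ → ℝ} {T : ℝ} (hT : 0 ≤ T)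
    (hh : ∀ t, HasDerivAt h (h' t) t)
    (hle : ∀ t, h t ∈ Ioo (h 0) (h T) → h' t ≤ φ (h t)) :
    ∫⁻ p in Ioo (h 0) (h T), (ENNReal.ofReal (φ p))⁻¹ ≤ ENNReal.ofReal T := by
  have hcont : Continuous h := continuous_iff_continuousAt.2 fun t => (hh t).continuousAt
  let A : ℝ → Set ℝ := fun p => {t | t ∈ Icc 0 T ∧ p ≤ h t}
  have hbdd : ∀ p, BddBelow (A p) := fun p => ⟨0, fun t ht => ht.1.1⟩
  have hne : ∀ p ≤ h T, (A p).Nonempty := fun p hp => ⟨T, ⟨hT, le_rfl⟩, hp⟩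
  have hclosed : ∀ p, IsClosed (A p) := fun p =>
    isClosed_Icc.inter (isClosed_le continuous_const hcont)
  let σ : ℝ → ℝ := fun p => sInf (A p)
  have hmem : ∀ p ∈ Ioo (h 0) (h T), σ p ∈ A p := fun p hp =>
    (hclosed p).csInf_mem (hne p hp.2.le) (hbdd p)
  -- `σ p` is the first time at which `h` reaches `p`
  have hlt : ∀ p, ∀ s, 0 ≤ s → s ≤ T → s < σ p → h s < p := by
    intro p s hs hsT hsσ
    by_contra hcon
    exact absurd (csInf_le (hbdd p) ⟨⟨hs, hsT⟩, not_lt.1 hcon⟩) (not_le.2 hsσ)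
  have hval : ∀ p ∈ Ioo (h 0) (h T), h (σ p) = p := by
    intro p hp
    obtain ⟨⟨h1, h2⟩, h3⟩ := hmem p hp
    obtain ⟨s, hs, hsp⟩ := intermediate_value_Icc h1 hcont.continuousOn ⟨hp.1.le, h3⟩
    rcases hs.2.eq_or_lt with h4 | h4
    · rw [← h4, hsp]
    · exact absurd hsp (hlt p s hs.1 (hs.2.trans h2) h4).ne
  have hmono : MonotoneOn σ (Ioo (h 0) (h T)) := fun p _ r hr hpr =>
    csInf_le_csInf (hbdd p) (hne r hr.2.le) fun t ht => ⟨ht.1, hpr.trans ht.2⟩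
  let S := σ '' Ioo (h 0) (h T)
  have hS : MeasurableSet S := measurableSet_Ioo.image_of_monotoneOn hmono
  have himage : h '' S = Ioo (h 0) (h T) := by
    rw [image_image]
    exact (image_congr hval).trans (image_id' _)
  have hinj : InjOn h S := by
    rintro _ ⟨p, hp, rfl⟩ _ ⟨r, hr, rfl⟩ heq
    rw [hval p hp, hval r hr] at heq
    rw [heq]
  have hsub : S ⊆ Icc 0 T := by
    rintro _ ⟨p, hp, rfl⟩
    exact (hmem p hp).1
  have hpos : ∀ t ∈ S, 0 ≤ h' t := by
    rintro _ ⟨p, hp, rfl⟩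
    have h0 : 0 < σ p := by
      refine lt_of_le_of_ne (hmem p hp).1.1 fun h0 => ?_
      have := hval p hp
      rw [← h0] at this
      exact hp.1.ne this
    have hlim := ((hasDerivAt_iff_tendsto_slope.1 (hh (σ p))).mono_left
      (nhdsWithin_mono _ fun s (hs : s ∈ Iio (σ p)) => ne_of_lt hs))
    refine ge_of_tendsto hlim ?_
    filter_upwards [Ioo_mem_nhdsLT h0] with s hs
    have h1 := hlt p s hs.1.le (hs.2.le.trans (hmem p hp).1.2) hs.2
    rw [slope_def_field, hval p hp]
    exact div_nonneg_of_nonpos (by linarith) (by linarith [hs.2])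
  rw [← himage, lintegral_image_eq_lintegral_abs_deriv_mul hS
    (fun t _ => (hh t).hasDerivWithinAt) hinj]
  calc ∫⁻ t in S, ENNReal.ofReal |h' t| * (ENNReal.ofReal (φ (h t)))⁻¹
      ≤ ∫⁻ t in S, 1 := by
        refine setLIntegral_mono measurable_const fun t ht => ?_
        rw [← div_eq_mul_inv, abs_of_nonneg (hpos t ht)]
        refine ENNReal.div_le_of_le_mul ?_
        rw [one_mul]
        exact ENNReal.ofReal_le_ofReal (hle t (himage ▸ mem_image_of_mem h ht))
    _ = volume S := by simp
    _ ≤ volume (Icc 0 T) := measure_mono hsub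
    _ = ENNReal.ofReal T := by simp

/-! ### Quantiles and the bathtub principle -/

section Quantile

variable {ν : Measure ℝ} {p : ℝ}

theorem ccdf_coe (ν : Measure ℝ) (c : ℝ) : ccdf ν c = ν (Ioi c) := by
  simp [ccdf, Ioi]

theorem lt_ccdf_of_lt_ccdfInv {c : EReal} (hc : c < ccdfInv ν p) :
    ENNReal.ofReal p < ccdf ν c :=
  not_le.1 fun h => absurd (sInf_le (s := {c : EReal | ccdf ν c ≤ ENNReal.ofReal p}) h) (not_le.2 hc)

/-- Right continuity of the complementary CDF: the infimum defining the quantile is attained. Hence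
the weight of the atom in `bathtubLaw` is not a truncated difference. -/
theorem ccdf_ccdfInv_le (ν : Measure ℝ) (p : ℝ) :
    ccdf ν (ccdfInv ν p) ≤ ENNReal.ofReal p := by
  by_cases hne : {c : EReal | ccdf ν c ≤ ENNReal.ofReal p}.Nonempty
  · obtain ⟨u, hu, hlim, hmem⟩ := exists_seq_tendsto_sInf hne (OrderBot.bddBelow _)
    have hset : {y : ℝ | ccdfInv ν p < (y : EReal)} = ⋃ k, {y : ℝ | u k < (y : EReal)} := by
      ext y
      simp only [mem_ofPred_eq, mem_iUnion]
      exact ⟨fun hy => (hlim.eventually_lt_const hy).exists,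
        fun ⟨k, hk⟩ => (sInf_le (hmem k)).trans_lt hk⟩
    have hmono : Monotone fun k => {y : ℝ | u k < (y : EReal)} :=
      fun i j hij y hy => (hu hij).trans_lt hy
    rw [ccdf, hset, hmono.measure_iUnion]
    exact iSup_le hmem
  · rw [ccdfInv, not_nonempty_iff_eq_empty.1 hne, sInf_empty]
    simp [ccdf]

theorem ccdfInv_ne_top [IsFiniteMeasure ν] (hp : 0 < p) : ccdfInv ν p ≠ ⊤ := by
  have hlim : Tendsto (fun c : ℝ => ν (Ioi c)) atTop (𝓝 0) := by
    have := tendsto_measure_iInter_atTop (μ := ν) (s := fun c : ℝ => Ioi c)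
      (fun c => measurableSet_Ioi.nullMeasurableSet) (fun a b hab => Ioi_subset_Ioi hab)
      ⟨0, measure_ne_top _ _⟩
    have hempty : ⋂ c : ℝ, Ioi c = ∅ := by
      ext y
      simpa using ⟨y, le_rfl⟩
    rwa [hempty, measure_empty] at this
  obtain ⟨c, hc⟩ := (hlim.eventually_lt_const (ENNReal.ofReal_pos.2 hp)).exists
  refine ne_top_of_le_ne_top (EReal.coe_ne_top c) (sInf_le ?_)
  rw [mem_ofPred_eq, ccdf_coe]
  exact hc.le

theorem ccdfInv_ne_bot [IsProbabilityMeasure ν] (hp : p < 1) : ccdfInv ν p ≠ ⊥ := by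
  intro hbot
  have hle := ccdf_ccdfInv_le ν p
  rw [hbot] at hle
  have h1 : ccdf ν ⊥ = 1 := by simp [ccdf]
  rw [h1, ← ENNReal.ofReal_one] at hle
  rcases le_or_gt 0 p with h0 | h0
  · exact absurd ((ENNReal.ofReal_le_ofReal_iff h0).1 hle) (not_le.2 hp)
  · rw [ENNReal.ofReal_of_nonpos h0.le] at hle
    simp at hle

theorem coe_toReal_ccdfInv [IsProbabilityMeasure ν] (hp : p ∈ Ioo (0 : ℝ) 1) :
    (((ccdfInv ν p).toReal : ℝ) : EReal) = ccdfInv ν p :=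
  EReal.coe_toReal (ccdfInv_ne_top hp.1) (ccdfInv_ne_bot hp.2)

theorem measureReal_Ioi_ccdfInv_le [IsProbabilityMeasure ν] (hp : p ∈ Ioo (0 : ℝ) 1) :
    ν.real (Ioi (ccdfInv ν p).toReal) ≤ p := by
  have h := ccdf_ccdfInv_le ν p
  rw [← coe_toReal_ccdfInv hp, ccdf_coe] at h
  exact ENNReal.toReal_le_of_le_ofReal hp.1.le h

theorem lt_measureReal_Ioi [IsProbabilityMeasure ν] (hp : p ∈ Ioo (0 : ℝ) 1) {c : ℝ}
    (hc : c < (ccdfInv ν p).toReal) : p < ν.real (Ioi c) := by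
  have h : (c : EReal) < ccdfInv ν p := by
    rw [← coe_toReal_ccdfInv hp]
    exact_mod_cast hc
  have h' := lt_ccdf_of_lt_ccdfInv h
  rw [ccdf_coe] at h'
  exact (ENNReal.ofReal_lt_iff_lt_toReal hp.1.le (measure_ne_top _ _)).1 h'

theorem integral_bathtubLaw [IsProbabilityMeasure ν] (hν : Integrable (fun y => y) ν)
    (hp : p ∈ Ioo (0 : ℝ) 1) :
    ∫ y, y ∂bathtubLaw ν p = (∫ y in Ioi (ccdfInv ν p).toReal, y ∂ν)
      + (p - ν.real (Ioi (ccdfInv ν p).toReal)) * (ccdfInv ν p).toReal := by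
  have hc := coe_toReal_ccdfInv (ν := ν) hp
  have hle := ccdf_ccdfInv_le ν p
  unfold bathtubLaw
  set c := (ccdfInv ν p).toReal
  rw [← hc] at hle ⊢
  have hset : {y : ℝ | (c : EReal) < (y : EReal)} = Ioi c := by
    ext y
    simp
  rw [ccdf_coe] at hle
  have hw : (ENNReal.ofReal p - ν (Ioi c)).toReal = p - ν.real (Ioi c) := by
    rw [ENNReal.toReal_sub_of_le hle ENNReal.ofReal_ne_top, ENNReal.toReal_ofReal hp.1.le,
      measureReal_def]
  have hd : ∀ a : ℝ, Integrable (fun y : ℝ => y) (Measure.dirac a) := fun a =>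
    integrable_dirac (by simp)
  rw [hset, ccdf_coe, integral_add_measure, integral_add_measure, integral_smul_measure,
    integral_smul_measure, integral_dirac, integral_dirac, hw]
  · simp
  · exact hν.restrict
  · exact (hd c).smul_measure (ENNReal.sub_ne_top ENNReal.ofReal_ne_top)
  · exact hν.restrict.add_measure ((hd c).smul_measure (ENNReal.sub_ne_top ENNReal.ofReal_ne_top))
  · exact (hd 0).smul_measure ENNReal.ofReal_ne_top

/-- A crude bound, uniform in `p`, which keeps the supremum in `Phi` away from the junk value of
an unbounded `sSup`. -/
theorem integral_bathtubLaw_le [IsProbabilityMeasure ν] (hν : Integrable (fun y => y) ν)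
    (hp : p ∈ Ioo (0 : ℝ) 1) : ∫ y, y ∂bathtubLaw ν p ≤ 3 * ∫ y, |y| ∂ν := by
  rw [integral_bathtubLaw hν hp]
  have hfirst : ∀ a : ℝ, ∫ y in Ioi a, |y| ∂ν ≤ ∫ y, |y| ∂ν := fun a =>
    setIntegral_le_integral hν.abs (ae_of_all _ fun y => abs_nonneg y)
  have h1 : ∫ y in Ioi (ccdfInv ν p).toReal, y ∂ν ≤ ∫ y, |y| ∂ν :=
    (integral_mono hν.restrict hν.abs.restrict fun y => le_abs_self y).trans (hfirst _)
  have h0 : 0 ≤ ∫ y, |y| ∂ν := integral_nonneg fun y => abs_nonneg y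
  have hsub := measureReal_Ioi_ccdfInv_le (ν := ν) hp
  have hlt := fun a => lt_measureReal_Ioi (ν := ν) hp (c := a)
  have hnn : 0 ≤ ν.real (Ioi (ccdfInv ν p).toReal) := measureReal_nonneg
  set c := (ccdfInv ν p).toReal
  rcases le_or_gt c 0 with hc | hc
  · nlinarith
  · -- Markov's inequality at `c / 2`, where the tail still exceeds `p`
    have h2 : c / 2 * ν.real (Ioi (c / 2)) ≤ ∫ y in Ioi (c / 2), |y| ∂ν := by
      have := setIntegral_mono_on (μ := ν) (s := Ioi (c / 2)) (f := fun _ => c / 2)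
        (g := fun y => |y|) (integrable_const _).integrableOn hν.abs.integrableOn measurableSet_Ioi
        fun y hy => (le_of_lt hy).trans (le_abs_self y)
      simpa [mul_comm] using this
    have h3 := hlt (c / 2) (by linarith)
    have h4 := hfirst (c / 2)
    nlinarith [mul_nonneg hnn hc.le]

end Quantile

/-- The bathtub principle: among the functions `f` with values in `[0, 1]` and a given integral
`p`, the integral of `f X` is largest when `f` fills up the superlevel sets of `X`, and then it is
the mean of `bathtubLaw`. With `c` the `p`-quantile, `f (X - c) ≤ (X - c)⁺` pointwise. -/
theorem integral_mul_le_integral_bathtubLaw {Ω : Type*} [MeasurableSpace Ω] {Q : Measure Ω}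
    [IsProbabilityMeasure Q] {X f : Ω → ℝ} (hXm : Measurable X) (hX : Integrable X Q)
    (hf : AEStronglyMeasurable f Q) (hf01 : ∀ x, f x ∈ Icc (0 : ℝ) 1)
    (hp : ∫ x, f x ∂Q ∈ Ioo (0 : ℝ) 1) :
    ∫ x, f x * X x ∂Q ≤ ∫ y, y ∂bathtubLaw (Q.map X) (∫ x, f x ∂Q) := by
  have : IsProbabilityMeasure (Q.map X) := Measure.isProbabilityMeasure_map hXm.aemeasurable
  have hν : Integrable (fun y : ℝ => y) (Q.map X) :=
    (integrable_map_measure (by fun_prop) hXm.aemeasurable).2 hX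
  have hfi : Integrable f Q := by
    refine Integrable.of_bound hf 1 (ae_of_all _ fun x => ?_)
    rw [Real.norm_eq_abs, abs_of_nonneg (hf01 x).1]
    exact (hf01 x).2
  rw [integral_bathtubLaw hν hp]
  set p := ∫ x, f x ∂Q
  set c := (ccdfInv (Q.map X) p).toReal
  have hms : MeasurableSet (X ⁻¹' Ioi c) := hXm measurableSet_Ioi
  have hXc : Integrable (fun x => X x - c) Q := hX.sub (integrable_const c)
  have hfX : Integrable (fun x => f x * (X x - c)) Q := by
    refine hXc.bdd_mul hf (c := 1) (ae_of_all _ fun x => ?_)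
    rw [Real.norm_eq_abs, abs_of_nonneg (hf01 x).1]
    exact (hf01 x).2
  have h1 : ∫ x, f x * X x ∂Q = (∫ x, f x * (X x - c) ∂Q) + p * c := by
    rw [← integral_mul_const, ← integral_add hfX (hfi.mul_const c)]
    exact integral_congr_ae (ae_of_all _ fun x => by ring)
  have h2 : ∫ x, f x * (X x - c) ∂Q ≤ ∫ x in X ⁻¹' Ioi c, (X x - c) ∂Q := by
    rw [← integral_indicator hms]
    refine integral_mono hfX (hXc.indicator hms) fun x => ?_
    by_cases hx : x ∈ X ⁻¹' Ioi c
    · rw [indicator_of_mem hx]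
      exact mul_le_of_le_one_left (sub_nonneg.2 (le_of_lt hx)) (hf01 x).2
    · rw [indicator_of_notMem hx]
      exact mul_nonpos_of_nonneg_of_nonpos (hf01 x).1 (sub_nonpos.2 (not_lt.1 hx))
  have h3 : ∫ x in X ⁻¹' Ioi c, (X x - c) ∂Q
      = (∫ y in Ioi c, y ∂Q.map X) - (Q.map X).real (Ioi c) * c := by
    rw [integral_sub hX.restrict (integrable_const c), setIntegral_map measurableSet_Ioi
      (by fun_prop) hXm.aemeasurable, map_measureReal_apply hXm measurableSet_Ioi]
    simp
  rw [h1]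
  linarith

/-! ### The unit ball of a norm -/

theorem isCompact_setOf_seminorm_le_one {E : Type*} [NormedAddCommGroup E] [NormedSpace ℝ E]
    [FiniteDimensional ℝ E] (N : Seminorm ℝ E) (hN : ∀ x, N x = 0 → x = 0) :
    IsCompact {x : E | N x ≤ 1} := by
  have hcont : Continuous N := continuousOn_univ.1 (N.convexOn.continuousOn isOpen_univ)
  refine Metric.isCompact_of_isClosed_isBounded (isClosed_le hcont continuous_const) ?_
  rcases subsingleton_or_nontrivial E with hE | hE
  · exact (Set.subsingleton_of_subsingleton (s := {x : E | N x ≤ 1})).finite.isBounded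
  · obtain ⟨w, hw, hmin⟩ := (isCompact_sphere (0 : E) 1).exists_isMinOn
      (NormedSpace.sphere_nonempty.2 zero_le_one) hcont.continuousOn
    -- the minimum of `N` on the Euclidean sphere compares `N` with the Euclidean norm
    have hw0 : 0 < N w := by
      refine lt_of_le_of_ne (apply_nonneg N w) fun h => ?_
      rw [mem_sphere_zero_iff_norm, hN w h.symm, norm_zero] at hw
      exact zero_ne_one hw
    refine (Metric.isBounded_closedBall (x := (0 : E)) (r := (N w)⁻¹)).subset fun x hx => ?_
    rw [mem_closedBall_zero_iff]
    rcases eq_or_ne x 0 with rfl | hx0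
    · simp [hw0.le]
    · have hn : 0 < ‖x‖ := norm_pos_iff.2 hx0
      have h1 : N w ≤ N (‖x‖⁻¹ • x) := hmin (by
        rw [mem_sphere_zero_iff_norm, norm_smul, norm_inv, norm_norm, inv_mul_cancel₀ hn.ne'])
      rw [map_smul_eq_mul, norm_inv, norm_norm] at h1
      have hx' : N x ≤ 1 := hx
      rw [le_inv_comm₀ hn hw0]
      exact h1.trans (mul_le_of_le_one_right (by positivity) hx')

/-! ### The probability measure with density `q` -/

section

variable {d : ℕ} {q : EuclideanSpace ℝ (Fin d) → ℝ} {μ : Measure (EuclideanSpace ℝ (Fin d))}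
  {n : EuclideanSpace ℝ (Fin d) → EuclideanSpace ℝ (Fin d)}

theorem integral_densityMeasure (hq : Integrable q volume) (hq_nonneg : 0 ≤ᵐ[volume] q)
    (f : EuclideanSpace ℝ (Fin d) → ℝ) :
    ∫ x, f x ∂densityMeasure q = ∫ x, q x * f x := by
  rw [densityMeasure, integral_withDensity_eq_integral_toReal_smul₀
    hq.aestronglyMeasurable.aemeasurable.ennreal_ofReal
    (ae_of_all _ fun x => ENNReal.ofReal_lt_top)]
  refine integral_congr_ae ?_
  filter_upwards [hq_nonneg] with x hx
  rw [ENNReal.toReal_ofReal hx, smul_eq_mul]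

theorem isProbabilityMeasure_densityMeasure (hq : Integrable q volume)
    (hq_nonneg : 0 ≤ᵐ[volume] q) (hq_one : ∫ x, q x = 1) :
    IsProbabilityMeasure (densityMeasure q) := by
  constructor
  rw [densityMeasure, withDensity_apply _ MeasurableSet.univ, Measure.restrict_univ,
    ← ofReal_integral_eq_lintegral_ofReal hq hq_nonneg, hq_one, ENNReal.ofReal_one]

theorem smoothing_mem_Icc (hq : Integrable q volume)
    (hq_nonneg : 0 ≤ᵐ[volume] q) (hq_one : ∫ x, q x = 1) {F : EuclideanSpace ℝ (Fin d) → ℝ}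
    (hF01 : ∀ x, F x ∈ Icc (0 : ℝ) 1) (x : EuclideanSpace ℝ (Fin d)) :
    smoothing q F x ∈ Icc (0 : ℝ) 1 := by
  have := isProbabilityMeasure_densityMeasure hq hq_nonneg hq_one
  rw [smoothing, ← integral_densityMeasure hq hq_nonneg]
  refine ⟨integral_nonneg fun z => (hF01 _).1, ?_⟩
  refine (integral_mono_of_nonneg (ae_of_all _ fun z => (hF01 _).1) (integrable_const 1)
    (ae_of_all _ fun z => (hF01 _).2)).trans ?_
  simp

/-! ### The derivative of a BV density tested against functions with values in `[0, 1]` -/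

namespace HasBVDeriv

variable (hBV : HasBVDeriv q μ n)
include hBV

theorem ae_abs_inner_le (u : EuclideanSpace ℝ (Fin d)) :
    ∀ᵐ x ∂μ, |inner ℝ u (n x)| ≤ ‖u‖ := by
  filter_upwards [hBV.norm_dir] with x hx
  simpa [hx] using abs_real_inner_le_norm u (n x)

theorem integrable_inner (u : EuclideanSpace ℝ (Fin d)) :
    Integrable (fun x => inner ℝ u (n x)) μ := by
  have := hBV.finite
  have := hBV.measurable_dir
  exact Integrable.of_bound (by fun_prop) ‖u‖ (hBV.ae_abs_inner_le u)

theorem integrable_mul_inner {f : EuclideanSpace ℝ (Fin d) → ℝ} (hf : Continuous f)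
    (hf01 : ∀ x, f x ∈ Icc (0 : ℝ) 1) (u : EuclideanSpace ℝ (Fin d)) :
    Integrable (fun x => f x * inner ℝ u (n x)) μ := by
  refine (hBV.integrable_inner u).bdd_mul (c := 1) hf.aestronglyMeasurable
    (ae_of_all _ fun x => ?_)
  rw [Real.norm_eq_abs, abs_of_nonneg (hf01 x).1]
  exact (hf01 x).2

theorem measurable_gamma (u : EuclideanSpace ℝ (Fin d)) : Measurable (gamma q μ n u) := by
  have := hBV.measurable_dir
  have := Measure.measurable_rnDeriv μ (densityMeasure q)
  unfold gamma
  fun_prop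

theorem integrable_gamma (u : EuclideanSpace ℝ (Fin d)) :
    Integrable (gamma q μ n u) (densityMeasure q) := by
  have := hBV.finite
  have h := (hBV.integrable_inner u).mono_measure
    (Measure.withDensity_rnDeriv_le μ (densityMeasure q))
  rw [integrable_withDensity_iff_integrable_smul' (Measure.measurable_rnDeriv _ _)
    (Measure.rnDeriv_lt_top _ _)] at h
  exact h.congr (ae_of_all _ fun x => mul_comm _ _)

/-- The absolutely continuous part of the variation measure, integrated against `n` in a
direction `u`, is the expectation of `γ_u`. -/
theorem integral_mul_gamma (f : EuclideanSpace ℝ (Fin d) → ℝ) (u : EuclideanSpace ℝ (Fin d)) :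
    ∫ x, f x * gamma q μ n u x ∂densityMeasure q
      = ∫ x, f x * inner ℝ u (n x)
        ∂(densityMeasure q).withDensity (μ.rnDeriv (densityMeasure q)) := by
  have := hBV.finite
  rw [integral_withDensity_eq_integral_toReal_smul (Measure.measurable_rnDeriv _ _)
    (Measure.rnDeriv_lt_top _ _)]
  refine integral_congr_ae (ae_of_all _ fun x => ?_)
  simp only [gamma, smul_eq_mul]
  ring

/-- The derivative of `q` in direction `u`, tested against a function `f` with values in `[0, 1]`:
the bathtub principle bounds the part that is absolutely continuous with respect to `q`, and
`theta` bounds the singular part, for which the integral of `f` against `q` is no constraint. -/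
theorem integral_mul_inner_le (hq_nonneg : 0 ≤ᵐ[volume] q) (hq_one : ∫ x, q x = 1)
    {f : EuclideanSpace ℝ (Fin d) → ℝ} (hf : Continuous f) (hf01 : ∀ x, f x ∈ Icc (0 : ℝ) 1)
    (hp : ∫ x, f x ∂densityMeasure q ∈ Ioo (0 : ℝ) 1) (u : EuclideanSpace ℝ (Fin d)) :
    ∫ x, f x * inner ℝ u (n x) ∂μ
      ≤ bathtubExpectation q μ n u (∫ x, f x ∂densityMeasure q) + theta q μ n u := by
  have := hBV.finite
  have := isProbabilityMeasure_densityMeasure hBV.integrable hq_nonneg hq_one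
  have : μ.HaveLebesgueDecomposition (densityMeasure q) :=
    Measure.haveLebesgueDecomposition_of_sigmaFinite _ _
  have hint := hBV.integrable_mul_inner hf hf01 u
  have hs := Measure.singularPart_le μ (densityMeasure q)
  have hdecomp : ∫ x, f x * inner ℝ u (n x) ∂μ
      = (∫ x, f x * inner ℝ u (n x) ∂μ.singularPart (densityMeasure q))
        + ∫ x, f x * gamma q μ n u x ∂densityMeasure q := by
    rw [hBV.integral_mul_gamma, ← integral_add_measure (hint.mono_measure hs)
      (hint.mono_measure (Measure.withDensity_rnDeriv_le _ _)),
      ← Measure.haveLebesgueDecomposition_add μ (densityMeasure q)]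
  have hsing : ∫ x, f x * inner ℝ u (n x) ∂μ.singularPart (densityMeasure q)
      ≤ theta q μ n u := by
    refine integral_mono (hint.mono_measure hs) ?_ fun x => ?_
    · have := ((hBV.integrable_inner u).mono_measure hs).pos_part
      simpa only [real_inner_comm, max_comm] using this
    · simp only [real_inner_comm u (n x)]
      rcases le_total 0 (inner ℝ u (n x)) with h | h
      · exact (mul_le_of_le_one_left h (hf01 x).2).trans (le_max_right _ _)
      · exact (mul_nonpos_of_nonneg_of_nonpos (hf01 x).1 h).trans (le_max_left _ _)
  have hac := integral_mul_le_integral_bathtubLaw (hBV.measurable_gamma u) (hBV.integrable_gamma u)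
    hf.aestronglyMeasurable hf01 hp
  rw [hdecomp, add_comm]
  exact add_le_add hac hsing

theorem bathtubExpectation_add_theta_le (hq_nonneg : 0 ≤ᵐ[volume] q) (hq_one : ∫ x, q x = 1)
    {p : ℝ} (hp : p ∈ Ioo (0 : ℝ) 1) (u : EuclideanSpace ℝ (Fin d)) :
    bathtubExpectation q μ n u p + theta q μ n u ≤ 4 * (‖u‖ * μ.real univ) := by
  have := hBV.finite
  have := isProbabilityMeasure_densityMeasure hBV.integrable hq_nonneg hq_one
  have hm := hBV.measurable_gamma u
  have : IsProbabilityMeasure ((densityMeasure q).map (gamma q μ n u)) :=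
    Measure.isProbabilityMeasure_map hm.aemeasurable
  have hν : Integrable (fun y : ℝ => y) ((densityMeasure q).map (gamma q μ n u)) :=
    (integrable_map_measure (by fun_prop) hm.aemeasurable).2 (hBV.integrable_gamma u)
  have hbound : ∀ ρ ≤ μ, ∫ x, |inner ℝ u (n x)| ∂ρ ≤ ‖u‖ * μ.real univ := fun ρ hρ => by
    have h1 : ∫ x, |inner ℝ u (n x)| ∂ρ ≤ ∫ x, |inner ℝ u (n x)| ∂μ :=
      integral_mono_measure hρ (ae_of_all _ fun x => abs_nonneg _) (hBV.integrable_inner u).abs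
    refine (h1.trans (integral_mono_ae (hBV.integrable_inner u).abs (integrable_const ‖u‖)
      (hBV.ae_abs_inner_le u))).trans_eq ?_
    simp [mul_comm]
  have h1 : bathtubExpectation q μ n u p ≤ 3 * (‖u‖ * μ.real univ) := by
    refine (integral_bathtubLaw_le hν hp).trans ?_
    rw [integral_map hm.aemeasurable (by fun_prop)]
    refine mul_le_mul_of_nonneg_left ?_ (by norm_num)
    refine le_trans (le_of_eq ?_)
      (hbound _ (Measure.withDensity_rnDeriv_le μ (densityMeasure q)))
    rw [integral_withDensity_eq_integral_toReal_smul (Measure.measurable_rnDeriv _ _)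
      (Measure.rnDeriv_lt_top _ _)]
    refine integral_congr_ae (ae_of_all _ fun x => ?_)
    simp only [gamma, smul_eq_mul, abs_mul, abs_of_nonneg ENNReal.toReal_nonneg, mul_comm]
  have h2 : theta q μ n u ≤ ‖u‖ * μ.real univ := by
    refine le_trans ?_ (hbound _ (Measure.singularPart_le μ (densityMeasure q)))
    refine integral_mono_of_nonneg (ae_of_all _ fun x => le_max_left _ _)
      ((hBV.integrable_inner u).mono_measure (Measure.singularPart_le _ _)).abs
      (ae_of_all _ fun x => ?_)
    simp only [real_inner_comm u (n x)]
    exact max_le (abs_nonneg _) (le_abs_self _)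
  linarith

/-- By Krein–Milman, the bound at the extreme points of the unit ball of `N` extends to the whole
ball, since the tested derivative is linear in the direction. The ball is symmetric, so the sign
is immaterial. -/
theorem neg_integral_mul_inner_le_Phi (hq_nonneg : 0 ≤ᵐ[volume] q) (hq_one : ∫ x, q x = 1)
    (N : Seminorm ℝ (EuclideanSpace ℝ (Fin d))) (hN : ∀ x, N x = 0 → x = 0)
    {f : EuclideanSpace ℝ (Fin d) → ℝ} (hf : Continuous f) (hf01 : ∀ x, f x ∈ Icc (0 : ℝ) 1)
    (hp : ∫ x, f x ∂densityMeasure q ∈ Ioo (0 : ℝ) 1) {v : EuclideanSpace ℝ (Fin d)}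
    (hv : N v ≤ 1) :
    -∫ x, f x * inner ℝ v (n x) ∂μ ≤ Phi N q μ n (∫ x, f x ∂densityMeasure q) := by
  have hK := isCompact_setOf_seminorm_le_one N hN
  obtain ⟨R, hR⟩ := hK.isBounded.exists_norm_le
  have hbdd : BddAbove ((fun u => bathtubExpectation q μ n u (∫ x, f x ∂densityMeasure q)
      + theta q μ n u) '' extremePoints ℝ {x : EuclideanSpace ℝ (Fin d) | N x ≤ 1}) := by
    refine ⟨4 * (R * μ.real univ), ?_⟩
    rintro _ ⟨u, hu, rfl⟩
    refine (hBV.bathtubExpectation_add_theta_le hq_nonneg hq_one hp u).trans ?_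
    have := hR u hu.1
    gcongr
  let l : EuclideanSpace ℝ (Fin d) →ₗ[ℝ] ℝ :=
    { toFun := fun w => ∫ x, f x * inner ℝ w (n x) ∂μ
      map_add' := fun w z => by
        rw [← integral_add (hBV.integrable_mul_inner hf hf01 w)
          (hBV.integrable_mul_inner hf hf01 z)]
        simp only [inner_add_left, mul_add]
      map_smul' := fun a w => by
        simp only [RingHom.id_apply, smul_eq_mul, real_inner_smul_left]
        rw [← integral_const_mul]
        exact integral_congr_ae (ae_of_all _ fun x => by ring) }
  have hhalf : Convex ℝ {w | l w ≤ Phi N q μ n (∫ x, f x ∂densityMeasure q)} :=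
    convex_halfSpace_le l.isLinear _
  have hclosed : IsClosed {w | l w ≤ Phi N q μ n (∫ x, f x ∂densityMeasure q)} :=
    isClosed_le l.continuous_of_finiteDimensional continuous_const
  have hKconv : Convex ℝ {x : EuclideanSpace ℝ (Fin d) | N x ≤ 1} := by
    simpa using N.convexOn.convex_le 1
  have hsub : {x : EuclideanSpace ℝ (Fin d) | N x ≤ 1}
      ⊆ {w | l w ≤ Phi N q μ n (∫ x, f x ∂densityMeasure q)} := by
    rw [← closure_convexHull_extremePoints hK hKconv]
    refine closure_minimal (convexHull_min (fun u hu => ?_) hhalf) hclosed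
    exact (hBV.integral_mul_inner_le hq_nonneg hq_one hf hf01 hp u).trans
      (le_csSup hbdd (mem_image_of_mem _ hu))
  have hneg : l (-v) ≤ Phi N q μ n (∫ x, f x ∂densityMeasure q) :=
    hsub (by simpa [map_neg_eq_map] using hv)
  rwa [map_neg] at hneg

end HasBVDeriv

/-! ### Differentiating the smoothing of a smooth function -/

theorem divergence_smul_const {g : EuclideanSpace ℝ (Fin d) → ℝ}
    {z : EuclideanSpace ℝ (Fin d)} (hg : DifferentiableAt ℝ g z)
    (v : EuclideanSpace ℝ (Fin d)) :
    divergence (fun z => g z • v) z = fderiv ℝ g z v := by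
  have hfd : fderiv ℝ (fun z => g z • v) z = (fderiv ℝ g z).smulRight v :=
    (hg.hasFDerivAt.smul_const v).fderiv
  conv_rhs => rw [← (EuclideanSpace.basisFun (Fin d) ℝ).sum_repr v]
  simp [divergence, hfd, mul_comm]

/-- The directional derivative of the smoothing of a test function: differentiate under the
integral sign, then move the derivative to `q` by testing the definition of `|Dq|` on the field
`z ↦ g (y + t v + z) v`. -/
theorem HasBVDeriv.hasDerivAt_smoothing (hBV : HasBVDeriv q μ n)
    {g : EuclideanSpace ℝ (Fin d) → ℝ} (hg : ContDiff ℝ 1 g) (hgc : HasCompactSupport g)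
    (y v : EuclideanSpace ℝ (Fin d)) (t : ℝ) :
    HasDerivAt (fun s : ℝ => smoothing q g (y + s • v))
      (-∫ z, g (y + t • v + z) * inner ℝ v (n z) ∂μ) t := by
  have hgd : Differentiable ℝ g := hg.differentiable one_ne_zero
  have hcont : Continuous fun z => fderiv ℝ g z v := (hg.continuous_fderiv one_ne_zero).clm_apply
    continuous_const
  obtain ⟨C, hC⟩ := (hgc.fderiv_apply ℝ v).exists_bound_of_continuous hcont
  obtain ⟨B, hB⟩ := hgc.exists_bound_of_continuous hg.continuous
  have hq := hBV.integrable
  have hshift : ContDiff ℝ 1 fun z => g (y + t • v + z) := hg.comp (contDiff_const.add contDiff_id)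
  have hparts := hBV.integral_by_parts (fun z => g (y + t • v + z) • v)
    (hshift.smul contDiff_const)
    ((hgc.comp_homeomorph (Homeomorph.addLeft (y + t • v))).smul_right)
  have hdiv : ∀ z, divergence (fun z => g (y + t • v + z) • v) z
      = fderiv ℝ g (y + t • v + z) v := fun z => by
    rw [divergence_smul_const (hshift.differentiable one_ne_zero z), fderiv_comp_add_left]
  simp only [hdiv, real_inner_smul_left] at hparts
  rw [← hparts]
  refine (hasDerivAt_integral_of_dominated_loc_of_deriv_le
    (F := fun (s : ℝ) z => q z * g (y + s • v + z))
    (F' := fun s z => q z * fderiv ℝ g (y + s • v + z) v)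
    (bound := fun z => ‖q z‖ * C) univ_mem (Eventually.of_forall fun s => ?_) ?_ ?_
    (ae_of_all _ fun z s _ => ?_) (hq.norm.mul_const C) (ae_of_all _ fun z s _ => ?_)).2
  · exact hq.aestronglyMeasurable.mul
      (hg.continuous.comp (continuous_const.add continuous_id)).aestronglyMeasurable
  · exact hq.mul_bdd (c := B) hshift.continuous.aestronglyMeasurable (ae_of_all _ fun z => hB _)
  · exact hq.aestronglyMeasurable.mul
      (hcont.comp (continuous_const.add continuous_id)).aestronglyMeasurable
  · rw [norm_mul]
    exact mul_le_mul_of_nonneg_left (hC _) (norm_nonneg _)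
  · have hline : HasDerivAt (fun s : ℝ => y + s • v + z) v s := by
      simpa using (((hasDerivAt_id s).smul_const v).const_add y).add_const z
    exact ((hgd _).hasFDerivAt.comp_hasDerivAt s hline).const_mul (q z)

end

/-! ### Approximation by test functions -/

open scoped Convolution in
/-- A measurable function with values in `[0, 1]` is an almost everywhere limit of test functions
with values in `[0, 1]`, obtained by mollification and cutoff. -/
theorem exists_contDiff_hasCompactSupport_ae_tendsto {d : ℕ}
    {F : EuclideanSpace ℝ (Fin d) → ℝ} (hF : AEMeasurable F volume)
    (hF01 : ∀ x, F x ∈ Icc (0 : ℝ) 1) :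
    ∃ g : ℕ → EuclideanSpace ℝ (Fin d) → ℝ,
      (∀ k, ContDiff ℝ 1 (g k)) ∧ (∀ k, HasCompactSupport (g k)) ∧
      (∀ k x, g k x ∈ Icc (0 : ℝ) 1) ∧
      ∀ᵐ x, Tendsto (fun k => g k x) atTop (𝓝 (F x)) := by
  have hloc : LocallyIntegrable F volume := by
    refine (locallyIntegrable_const (1 : ℝ)).mono hF.aestronglyMeasurable
      (ae_of_all _ fun x => ?_)
    rw [Real.norm_eq_abs, abs_of_nonneg (hF01 x).1]
    simpa using (hF01 x).2
  -- mollifiers of radius tending to zero, and cutoffs equal to one on balls of radius `k`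
  let ρ : ℕ → ContDiffBump (0 : EuclideanSpace ℝ (Fin d)) := fun k =>
    { rIn := 1 / ((k : ℝ) + 1)
      rOut := 2 * (1 / ((k : ℝ) + 1))
      rIn_pos := by positivity
      rIn_lt_rOut := by
        have : 0 < 1 / ((k : ℝ) + 1) := by positivity
        linarith }
  let χ : ℕ → ContDiffBump (0 : EuclideanSpace ℝ (Fin d)) := fun k =>
    { rIn := (k : ℝ) + 1
      rOut := (k : ℝ) + 2
      rIn_pos := by positivity
      rIn_lt_rOut := by linarith }
  let c : ℕ → EuclideanSpace ℝ (Fin d) → ℝ := fun k =>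
    (ρ k).normed volume ⋆[ContinuousLinearMap.lsmul ℝ ℝ, volume] F
  have hc01 : ∀ k x, c k x ∈ Icc (0 : ℝ) 1 := by
    intro k x
    have h0 : ∀ t, 0 ≤ (ρ k).normed volume t := (ρ k).nonneg_normed
    refine ⟨integral_nonneg fun t => mul_nonneg (h0 t) (hF01 _).1, ?_⟩
    rw [← (ρ k).integral_normed (μ := volume)]
    exact integral_mono_of_nonneg (ae_of_all _ fun t => mul_nonneg (h0 t) (hF01 _).1)
      (ρ k).integrable_normed (ae_of_all _ fun t => mul_le_of_le_one_right (h0 t) (hF01 _).2)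
  refine ⟨fun k x => χ k x * c k x, fun k => ?_, fun k => ?_, fun k x => ?_, ?_⟩
  · exact (χ k).contDiff.mul ((ρ k).hasCompactSupport_normed.contDiff_convolution_left _
      (n := 1) (ρ k).contDiff_normed hloc)
  · exact (χ k).hasCompactSupport.mul_right
  · exact ⟨mul_nonneg (χ k).nonneg (hc01 k x).1,
      mul_le_one₀ (χ k).le_one (hc01 k x).1 (hc01 k x).2⟩
  · have hr : Tendsto (fun k => (ρ k).rOut) atTop (𝓝 0) := by
      have h : Tendsto (fun k : ℕ => 2 * (1 / ((k : ℝ) + 1))) atTop (𝓝 0) := by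
        simpa using (tendsto_one_div_add_atTop_nhds_zero_nat (𝕜 := ℝ)).const_mul 2
      exact h
    filter_upwards [ContDiffBump.ae_convolution_tendsto_right_of_locallyIntegrable (K := 2) hr
      (Eventually.of_forall fun k => le_rfl) hloc] with x hx
    obtain ⟨m, hm⟩ := exists_nat_ge ‖x‖
    refine hx.congr' ?_
    filter_upwards [eventually_ge_atTop m] with k hk
    have hxk : x ∈ Metric.closedBall 0 (χ k).rIn := by
      rw [mem_closedBall_zero_iff]
      have : (m : ℝ) ≤ k := by exact_mod_cast hk
      change ‖x‖ ≤ (k : ℝ) + 1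
      linarith
    rw [(χ k).one_of_mem_closedBall hxk, one_mul]

theorem tendsto_smoothing {d : ℕ} {q F : EuclideanSpace ℝ (Fin d) → ℝ}
    (hq : Integrable q volume) {g : ℕ → EuclideanSpace ℝ (Fin d) → ℝ}
    (hgm : ∀ k, Continuous (g k)) (hg01 : ∀ k x, g k x ∈ Icc (0 : ℝ) 1)
    (hlim : ∀ᵐ x, Tendsto (fun k => g k x) atTop (𝓝 (F x))) (y : EuclideanSpace ℝ (Fin d)) :
    Tendsto (fun k => smoothing q (g k) y) atTop (𝓝 (smoothing q F y)) := by
  refine tendsto_integral_of_dominated_convergence (fun z => ‖q z‖) (fun k => ?_) hq.norm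
    (fun k => ae_of_all _ fun z => ?_) ?_
  · exact hq.aestronglyMeasurable.mul
      ((hgm k).comp (continuous_const.add continuous_id)).aestronglyMeasurable
  · rw [norm_mul]
    refine mul_le_of_le_one_right (norm_nonneg _) ?_
    rw [Real.norm_eq_abs, abs_of_nonneg (hg01 _ _).1]
    exact (hg01 _ _).2
  · filter_upwards [(measurePreserving_add_left volume y).quasiMeasurePreserving.ae hlim]
      with z hz
    exact hz.const_mul (q z)

/-! ### The differential method for test functions -/

/-- The differential method for a test function `g`: along the segment from `x` to `x + δ`,
traversed at unit `N`-speed, the smoothing of `g` grows at a rate of at most `Phi` of its value. -/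
theorem HasBVDeriv.setLIntegral_inv_Phi_le {d : ℕ} {q : EuclideanSpace ℝ (Fin d) → ℝ}
    {μ : Measure (EuclideanSpace ℝ (Fin d))}
    {n : EuclideanSpace ℝ (Fin d) → EuclideanSpace ℝ (Fin d)} (hBV : HasBVDeriv q μ n)
    (hq_nonneg : 0 ≤ᵐ[volume] q) (hq_one : ∫ x, q x = 1)
    (N : Seminorm ℝ (EuclideanSpace ℝ (Fin d))) (hN : ∀ x, N x = 0 → x = 0)
    {g : EuclideanSpace ℝ (Fin d) → ℝ} (hg : ContDiff ℝ 1 g) (hgc : HasCompactSupport g)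
    (hg01 : ∀ x, g x ∈ Icc (0 : ℝ) 1) (x δ : EuclideanSpace ℝ (Fin d)) :
    ∫⁻ p in Ioo (smoothing q g x) (smoothing q g (x + δ)), (ENNReal.ofReal (Phi N q μ n p))⁻¹
      ≤ ENNReal.ofReal (N δ) := by
  set v := (N δ)⁻¹ • δ
  have hv : N v ≤ 1 := by
    rw [map_smul_eq_mul, norm_inv, Real.norm_of_nonneg (apply_nonneg N δ)]
    exact inv_mul_le_one
  have hδ : N δ • v = δ := by
    rcases eq_or_ne (N δ) 0 with h | h
    · rw [h, zero_smul, hN δ h]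
    · exact smul_inv_smul₀ h δ
  have h01 := smoothing_mem_Icc hBV.integrable hq_nonneg hq_one hg01
  have hrate := setLIntegral_inv_le_of_deriv_le (φ := Phi N q μ n) (apply_nonneg N δ)
    (fun t => hBV.hasDerivAt_smoothing hg hgc x v t) fun t ht => by
      have hp : ∫ z, g (x + t • v + z) ∂densityMeasure q = smoothing q g (x + t • v) :=
        integral_densityMeasure hBV.integrable hq_nonneg _
      rw [← hp] at ht ⊢
      exact hBV.neg_integral_mul_inner_le_Phi hq_nonneg hq_one N hN
        (hg.continuous.comp (continuous_const.add continuous_id)) (fun z => hg01 _)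
        ⟨(h01 _).1.trans_lt ht.1, ht.2.trans_le (h01 _).2⟩ hv
  simpa only [zero_smul, add_zero, hδ] using hrate

/-! ### Passing to the limit -/

theorem Ioo_eq_iUnion_Ioo (a b : ℝ) :
    Ioo a b = ⋃ j : ℕ, Ioo (a + 1 / ((j : ℝ) + 1)) (b - 1 / ((j : ℝ) + 1)) := by
  have hpos : ∀ j : ℕ, 0 < 1 / ((j : ℝ) + 1) := fun j => by positivity
  ext p
  simp only [mem_iUnion, mem_Ioo]
  constructor
  · rintro ⟨h1, h2⟩
    obtain ⟨j, hj⟩ := exists_nat_one_div_lt (lt_min (sub_pos.2 h1) (sub_pos.2 h2))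
    exact ⟨j, by linarith [hj.trans_le (min_le_left _ _)],
      by linarith [hj.trans_le (min_le_right _ _)]⟩
  · rintro ⟨j, h1, h2⟩
    exact ⟨by linarith [hpos j], by linarith [hpos j]⟩

/-- A bound on `∫⁻ f` over intervals passes to the limit of the intervals, for an arbitrary `f`,
which need neither be integrable nor measurable: exhaust the limit interval from inside. -/
theorem setLIntegral_Ioo_le_of_tendsto {f : ℝ → ℝ≥0∞} {C : ℝ≥0∞} {a b : ℕ → ℝ} {A B B' : ℝ}
    (ha : Tendsto a atTop (𝓝 A)) (hb : Tendsto b atTop (𝓝 B')) (hB : B ≤ B')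
    (h : ∀ k, ∫⁻ p in Ioo (a k) (b k), f p ≤ C) : ∫⁻ p in Ioo A B, f p ≤ C := by
  have hpos : ∀ j : ℕ, 0 < 1 / ((j : ℝ) + 1) := fun j => by positivity
  have hmono : Monotone fun j : ℕ => Ioo (A + 1 / ((j : ℝ) + 1)) (B - 1 / ((j : ℝ) + 1)) :=
    fun i j hij => by
      have := Nat.one_div_le_one_div (α := ℝ) hij
      exact Ioo_subset_Ioo (by linarith) (by linarith)
  rw [Ioo_eq_iUnion_Ioo A B, setLIntegral_iUnion_of_directed _ hmono.directed_le]
  refine iSup_le fun j => ?_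
  obtain ⟨k, hak, hbk⟩ := ((ha.eventually_lt_const (lt_add_of_pos_right A (hpos j))).and
    (hb.eventually_const_lt ((sub_lt_self B (hpos j)).trans_le hB))).exists
  exact (lintegral_mono_set (Ioo_subset_Ioo hak.le hbk.le)).trans (h k)

end BVSmoothing

/-- The differential method for densities of bounded variation. The radius is a Lebesgue integral
with values in `[0, ∞]`, so the case of a divergent integral is included. -/
theorem mainTheorem9 (d : ℕ)
    (N : Seminorm ℝ (EuclideanSpace ℝ (Fin d))) (hN : ∀ x, N x = 0 → x = 0)
    (q : EuclideanSpace ℝ (Fin d) → ℝ) (hq_nonneg : 0 ≤ᵐ[volume] q) (hq_one : ∫ x, q x = 1)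
    (μ : Measure (EuclideanSpace ℝ (Fin d)))
    (n : EuclideanSpace ℝ (Fin d) → EuclideanSpace ℝ (Fin d))
    (hBV : BVSmoothing.HasBVDeriv q μ n)
    (F : EuclideanSpace ℝ (Fin d) → ℝ) (hF : AEMeasurable F volume)
    (hF01 : ∀ x, F x ∈ Set.Icc (0 : ℝ) 1)
    (x : EuclideanSpace ℝ (Fin d)) (hx : BVSmoothing.smoothing q F x < 1 / 2)
    (δ : EuclideanSpace ℝ (Fin d))
    (hδ : ENNReal.ofReal (N δ) <
      ∫⁻ p in Set.Ioc (BVSmoothing.smoothing q F x) (1 / 2),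
        (ENNReal.ofReal (BVSmoothing.Phi N q μ n p))⁻¹) :
    BVSmoothing.smoothing q F (x + δ) < 1 / 2 := by
  by_contra hcon
  obtain ⟨g, hg, hgc, hg01, hlim⟩ :=
    BVSmoothing.exists_contDiff_hasCompactSupport_ae_tendsto hF hF01
  have hconv := BVSmoothing.tendsto_smoothing hBV.integrable (fun k => (hg k).continuous) hg01 hlim
  have hle := BVSmoothing.setLIntegral_Ioo_le_of_tendsto (hconv x) (hconv (x + δ))
    (not_lt.1 hcon) fun k =>
      hBV.setLIntegral_inv_Phi_le hq_nonneg hq_one N hN (hg k) (hgc k) (hg01 k) x δ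
  rw [← setLIntegral_congr Ioo_ae_eq_Ioc] at hδ
  exact absurd hle (not_le.2 hδ)
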